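/- Let $n\in\mathbb N$, $r>0$, and let $C^0=C^0([-r,0];\mathbb R^n)$ carry the sup norm $\|\cdot\|_\infty$. Let $f:C^0\to\mathbb R^n$ satisfy $f(0)=0$ and be Lipschitz on bounded sets: there is a non-decreasing $L:\mathbb R_+\to\mathbb R_+$ such that $|f(x)-f(y)|\le L(R)\|x-y\|_\infty$ for every $R\ge 0$ and all $x,y\in C^0$ with $\|x\|_\infty,\|y\|_\infty\le R$. Consider the time-delay system $$\dot x(t)=f(x_t),\qquad x_t(s)=x(t+s)\ \ (s\in[-r,0]),\qquad t\ge 0,$$ and let $\phi(t,x_0)=x_t$, where $x$ is the solution with initial condition $x_0\in C^0$. Let $p\in(1,\infty]$ and let $X$ be either of the following normed spaces of functions $x:[-r,0]\to\mathbb R^n$ (with $1/\infty=0$): - the Sobolev space $W^{1,p}([-r,0])$ of absolutely continuous functions with derivative in $L^p((-r,0);\mathbb R^n)$, with norm $\|x\|_X=\|x\|_\infty+\|\dot x\|_p$; - the Hölder space $C^{0,1-1/p}([-r,0])$, with norm $\|x\|_X=\max\Big(\|x\|_\infty,\ \sup_{t\ne s}\frac{|x(t)-x(s)|}{|t-s|^{1-1/p}}\Big)$.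 A function $\rho:\mathbb R_+\to\mathbb R_+$ is of class $K$ if it is continuous and strictly increasing with $\rho(0)=0$, and of class $K_\infty$ if moreover $\rho(s)\to\infty$ as $s\to\infty$. A function $\sigma:\mathbb R_+\times\mathbb R_+\to\mathbb R_+$ is of class $KL$ if $\sigma(\cdot,t)$ is of class $K$ for each $t\ge 0$ and, for each $s\ge0$, $\sigma(s,\cdot)$ is non-increasing with $\sigma(s,t)\to0$ as $t\to\infty$. Then the following two statements are equivalent. In both of them it is part of the statement that $\phi(t,x)$ exists and lies in $X$ for all $x\in X$ and all $t\ge 0$. 1. (Uniform global asymptotic stability in $X$.) There is $\sigma$ of class $KL$ such that $\|\phi(t,x)\|_X\le\sigma(\|x\|_X,t)$ for all $t\ge 0$ and all $x\in X$. 2. There are a functional $V:X\to\mathbb R_+$ and functions $a_1,a_2$ of class $K_\infty$ such that $V$ is Lipschitz on bounded sets of $X$ (for every $R\ge 0$ there is $M\ge 0$ with $|V(x)-V(y)|\le M\|x-y\|_X$ for all $x,y\in X$ with $\|x\|_X,\|y\|_X\le R$) and, for all $x\in X$, $$a_1(\|x\|_X)\le V(x)\le a_2(\|x\|_X),\qquad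 V(\phi(t,x))\le e^{-t}V(x)\ \text{ for all } t\ge 0.$$ -/

import Mathlib

open Set Filter Topology MeasureTheory
open scoped NNReal ENNReal

namespace DelaySystem

/-- The space `C⁰([-r,0]; ℝⁿ)`; its norm is the sup norm built on the Euclidean norm of `ℝⁿ`. -/
abbrev Hist (n : ℕ) (r : ℝ) : Type := C(Icc (-r) 0, EuclideanSpace ℝ (Fin n))

/-- `f` is Lipschitz on bounded sets of `C⁰([-r,0]; ℝⁿ)`. -/
def LipschitzOnBounded {n : ℕ} {r : ℝ} (f : Hist n r → EuclideanSpace ℝ (Fin n)) : Prop :=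
  ∃ L : ℝ≥0 → ℝ≥0, Monotone L ∧ ∀ (R : ℝ≥0) (x y : Hist n r),
    ‖x‖ ≤ R → ‖y‖ ≤ R → ‖f x - f y‖ ≤ L R * ‖x - y‖

/-- The segment `x_t ∈ C⁰([-r,0]; ℝⁿ)`, `x_t(s) = x(t + s)`, of a continuous function `x` on
`[-r, ∞)`, for `t ≥ 0`. -/
def segment {n : ℕ} {r : ℝ} (x : C(Ici (-r), EuclideanSpace ℝ (Fin n))) (t : ℝ≥0) :
    Hist n r where
  toFun s := x ⟨t + s, by
    have h1 : -r ≤ (s : ℝ) := s.2.1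
    have h2 : (0 : ℝ) ≤ t := t.2
    exact mem_Ici.2 (by linarith)⟩
  continuous_toFun := by fun_prop

/-- `x : [-r, ∞) → ℝⁿ` is the solution of `x'(t) = f(x_t)`, `t ≥ 0`, with initial condition `x₀`,
and it exists for all times. The derivative is two-sided for `t > 0` and from the right at
`t = 0`. When `f` is Lipschitz on bounded sets there is at most one such `x`, and
`segment x t` is then the value `φ(t, x₀)` of the flow. -/
structure IsGlobalSolution {n : ℕ} {r : ℝ} (f : Hist n r → EuclideanSpace ℝ (Fin n))
    (x₀ : Hist n r) (x : C(Ici (-r), EuclideanSpace ℝ (Fin n))) : Prop where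
  initial : segment x 0 = x₀
  deriv_eq : ∀ t : ℝ≥0, HasDerivWithinAt (IciExtend x) (f (segment x t)) (Ici 0) (t : ℝ)

/-- Class `K`. -/
structure ClassK (ρ : ℝ≥0 → ℝ≥0) : Prop where
  strictMono : StrictMono ρ
  continuous : Continuous ρ
  map_zero : ρ 0 = 0

/-- Class `K_∞`. -/
structure ClassKInfty (ρ : ℝ≥0 → ℝ≥0) : Prop extends ClassK ρ where
  tendsto_atTop : Tendsto ρ atTop atTop

/-- Class `KL`. -/
structure ClassKL (σ : ℝ≥0 → ℝ≥0 → ℝ≥0) : Prop where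
  classK : ∀ t, ClassK fun s => σ s t
  antitone : ∀ s, Antitone (σ s)
  tendsto_zero : ∀ s, Tendsto (σ s) atTop (𝓝 0)

/-- The derivative of `x : [-r,0] → ℝⁿ`, used on the open interval `(-r, 0)` only. -/
noncomputable def histDeriv {n : ℕ} {r : ℝ} (hr : 0 < r) (x : Hist n r) :
    ℝ → EuclideanSpace ℝ (Fin n) :=
  deriv (IccExtend (by linarith : -r ≤ 0) x)

/-- The Sobolev space `W^{1,p}([-r,0])`: absolutely continuous functions on `[-r,0]` with
derivative in `L^p((-r,0); ℝⁿ)`. -/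
def sobolevSpace (n : ℕ) {r : ℝ} (hr : 0 < r) (p : ℝ≥0∞) : Set (Hist n r) :=
  {x | AbsolutelyContinuousOnInterval (IccExtend (by linarith : -r ≤ 0) x) (-r) 0 ∧
    MemLp (histDeriv hr x) p (volume.restrict (Ioo (-r) 0))}

/-- The Sobolev norm `‖x‖_∞ + ‖x'‖_p`. -/
noncomputable def sobolevNorm (n : ℕ) {r : ℝ} (hr : 0 < r) (p : ℝ≥0∞) (x : Hist n r) : ℝ≥0 :=
  ‖x‖₊ + (eLpNorm (histDeriv hr x) p (volume.restrict (Ioo (-r) 0))).toNNReal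

/-- The Hölder space `C^{0,a}([-r,0])`. -/
def holderSpace (n : ℕ) (r : ℝ) (a : ℝ≥0) : Set (Hist n r) :=
  {x | MemHolder a x}

/-- The Hölder norm: the maximum of `‖x‖_∞` and the best Hölder constant
`sup_{t ≠ s} |x(t) - x(s)| / |t - s|^a`. -/
noncomputable def holderNorm (n : ℕ) (r : ℝ) (a : ℝ≥0) (x : Hist n r) : ℝ≥0 :=
  max ‖x‖₊ (nnHolderNorm a x)

/-- Uniform global asymptotic stability of `x'(t) = f(x_t)` in the state space `X` with norm `N`:
there is `σ ∈ KL` such that for all `x₀ ∈ X` and `t ≥ 0` the state `φ(t, x₀)` exists, lies in `X`,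
and `‖φ(t, x₀)‖_X ≤ σ(‖x₀‖_X, t)`. -/
def UGAS {n : ℕ} {r : ℝ} (f : Hist n r → EuclideanSpace ℝ (Fin n))
    (X : Set (Hist n r)) (N : Hist n r → ℝ≥0) : Prop :=
  ∃ σ : ℝ≥0 → ℝ≥0 → ℝ≥0, ClassKL σ ∧ ∀ x₀ ∈ X,
    ∃ x, IsGlobalSolution f x₀ x ∧ ∀ t : ℝ≥0, segment x t ∈ X ∧ N (segment x t) ≤ σ (N x₀) t

/-- The functional `V : X → ℝ₊` is Lipschitz on bounded sets of `X`, where `X` has norm `N`. -/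
def FunctionalLipschitzOnBounded {n : ℕ} {r : ℝ} {X : Set (Hist n r)} (N : Hist n r → ℝ≥0)
    (V : X → ℝ≥0) : Prop :=
  ∀ R : ℝ≥0, ∃ L : ℝ≥0, ∀ x y : X, N x ≤ R → N y ≤ R →
    |(V x : ℝ) - V y| ≤ L * N ((x : Hist n r) - y)

/-- Existence of a coercive Lyapunov functional on `X` that decays like `exp(-t)` along the flow:
`V` is Lipschitz on bounded sets of `X`, `a₁(‖x‖_X) ≤ V(x) ≤ a₂(‖x‖_X)`, and for all `x₀ ∈ X` and
`t ≥ 0` the state `φ(t, x₀)` exists, lies in `X`, and `V(φ(t, x₀)) ≤ exp(-t) V(x₀)`. -/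
def HasLyapunovFunctional {n : ℕ} {r : ℝ} (f : Hist n r → EuclideanSpace ℝ (Fin n))
    (X : Set (Hist n r)) (N : Hist n r → ℝ≥0) : Prop :=
  ∃ (V : X → ℝ≥0) (a₁ a₂ : ℝ≥0 → ℝ≥0),
    FunctionalLipschitzOnBounded N V ∧ ClassKInfty a₁ ∧ ClassKInfty a₂ ∧
    (∀ x : X, a₁ (N x) ≤ V x ∧ V x ≤ a₂ (N x)) ∧
    ∀ x₀ : X, ∃ x, IsGlobalSolution f x₀ x ∧ ∀ t : ℝ≥0, ∃ h : segment x t ∈ X,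
      (V ⟨segment x t, h⟩ : ℝ) ≤ Real.exp (-(t : ℝ)) * V x₀

end DelaySystem

/-! From 2 to 1: `a₁(‖φ(t,x)‖) ≤ V(φ(t,x)) ≤ e^{-t} a₂(‖x‖)`, so `σ(s,t) = a₁⁻¹(e^{-t} a₂(s))`
works.

From 1 to 2: for `δ > 0` put `W_δ(x) = sup_s e^s max(‖φ(s,x)‖ - δ, 0)`. Orbits starting in a given
ball stay in the `δ`-ball after a common time, so only a bounded time window contributes: `W_δ` is
finite, and it is Lipschitz on bounded sets as soon as the flow is, uniformly on bounded time
intervals. The weight `e^s` gives `W_δ(φ(t,x)) ≤ e^{-t} W_δ(x)`. A single `W_δ` is not coercive near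
the origin, so `V` is a sum of `c_k W_{1/(k+1)}` with `c_k` small enough to keep the Lipschitz
constants summable.

What remains is Lipschitz dependence of the flow on initial data in the norm of `X`. In the sup norm
it is a delayed Gronwall estimate. For the finer norm, a segment of the difference of two solutions
consists of a piece of the initial difference, controlled in `X`, and a piece with derivative
`f(x_t) - f(y_t)`, controlled by the sup norm. This last property is all that is asked of the
Sobolev and Hölder norms beyond elementary ones (`IsStateSpace`). -/

namespace DelaySystem

/-! ### Comparison functions. -/

section ComparisonFunctions

/-- A quantity bounded on bounded sets by a linear function is bounded by a `K_∞` function. -/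
lemma exists_classKInfty_majorant (B : ℝ≥0 → ℝ≥0) :
    ∃ a : ℝ≥0 → ℝ≥0, ClassKInfty a ∧ ∀ s, B ⌈s⌉₊ * s ≤ a s := by
  -- Summing the values of `B` makes the bound monotone; integrating it makes it continuous.
  set b : ℝ → ℝ := fun u => ∑ j ∈ Finset.range (⌈u⌉₊ + 1), (B j : ℝ) with hb
  have hbmono : Monotone b := by
    intro u v huv
    refine Finset.sum_le_sum_of_subset_of_nonneg ?_ fun _ _ _ => NNReal.coe_nonneg _
    exact Finset.range_mono (by have := Nat.ceil_mono huv; omega)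
  have hb0 : ∀ u, 0 ≤ b u := fun u => Finset.sum_nonneg fun _ _ => NNReal.coe_nonneg _
  have hint : ∀ u v, IntervalIntegrable b volume u v := fun u v => hbmono.intervalIntegrable
  set G : ℝ → ℝ := fun u => ∫ v in (0 : ℝ)..u, b v with hG
  have hGcont : Continuous G := intervalIntegral.continuous_primitive hint 0
  have hGmono : Monotone G := by
    intro u v huv
    have h := intervalIntegral.integral_add_adjacent_intervals (hint 0 u) (hint u v)
    have h' := intervalIntegral.integral_nonneg (μ := volume) huv fun w _ => hb0 w
    simp only [hG]
    linarith
  have hG0 : G 0 = 0 := by simp [hG]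
  have hGnn : ∀ s : ℝ≥0, 0 ≤ G (2 * s) := fun s => hG0 ▸ hGmono (by positivity)
  have hval : ∀ s : ℝ≥0, ((s + (G (2 * s)).toNNReal : ℝ≥0) : ℝ) = s + G (2 * s) := fun s => by
    rw [NNReal.coe_add, Real.coe_toNNReal _ (hGnn s)]
  -- The integral over `[s, 2s]` alone is at least `s * b s`; the extra summand `s` gives strictness
  -- and unboundedness.
  refine ⟨fun s => s + (G (2 * s)).toNNReal, ⟨⟨?_, ?_, ?_⟩, ?_⟩, fun s => ?_⟩
  · intro s t hst
    exact add_lt_add_of_lt_of_le hst (Real.toNNReal_mono (hGmono (by gcongr)))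
  · fun_prop
  · simp [hG0]
  · exact tendsto_atTop_mono (fun s => le_self_add) tendsto_id
  · rw [← NNReal.coe_le_coe, hval]
    have h1 : (B ⌈s⌉₊ : ℝ) ≤ b s := by
      refine Finset.single_le_sum (f := fun j : ℕ => (B j : ℝ)) (fun _ _ => NNReal.coe_nonneg _) ?_
      have : s ≤ (⌈(s : ℝ)⌉₊ : ℝ≥0) := by exact_mod_cast Nat.le_ceil (s : ℝ)
      simpa using this
    have h2 : G (2 * s) = G s + ∫ v in (s : ℝ)..(2 * s), b v :=
      (intervalIntegral.integral_add_adjacent_intervals (hint 0 s) (hint s (2 * s))).symm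
    have h3 : ∫ _ in (s : ℝ)..(2 * s), b s ≤ ∫ v in (s : ℝ)..(2 * s), b v := by
      refine intervalIntegral.integral_mono_on (by linarith [s.2]) (by simp) (hint _ _) ?_
      exact fun v hv => hbmono hv.1
    rw [intervalIntegral.integral_const, smul_eq_mul] at h3
    have h4 : 0 ≤ G s := hG0 ▸ hGmono s.2
    have h5 : (B ⌈s⌉₊ : ℝ) * s ≤ b s * s := mul_le_mul_of_nonneg_right h1 s.2
    push_cast
    have := s.2
    nlinarith

/-- A `K_∞` function is an order isomorphism of `[0, ∞)`. -/
noncomputable def ClassKInfty.orderIso {a : ℝ≥0 → ℝ≥0} (ha : ClassKInfty a) : ℝ≥0 ≃o ℝ≥0 :=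
  ha.strictMono.orderIsoOfSurjective a <| by
    intro y
    obtain ⟨s, hs⟩ := (ha.tendsto_atTop.eventually_ge_atTop y).exists
    obtain ⟨t, -, ht⟩ := intermediate_value_Icc (zero_le : 0 ≤ s) ha.continuous.continuousOn
      (show y ∈ Icc (a 0) (a s) from ⟨by simp [ha.map_zero], hs⟩)
    exact ⟨t, ht⟩

lemma ClassKInfty.orderIso_apply {a : ℝ≥0 → ℝ≥0} (ha : ClassKInfty a) (s : ℝ≥0) :
    ha.orderIso s = a s := rfl

/-- The comparison function `a₁⁻¹(e^{-t} a₂(s))` is of class `KL`. -/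
lemma classKL_symm_exp_mul {a₁ a₂ : ℝ≥0 → ℝ≥0} (h₁ : ClassKInfty a₁) (h₂ : ClassKInfty a₂) :
    ClassKL fun s t => h₁.orderIso.symm ((Real.exp (-(t : ℝ))).toNNReal * a₂ s) := by
  have h0 : h₁.orderIso.symm 0 = 0 := by
    rw [OrderIso.symm_apply_eq, h₁.orderIso_apply, h₁.map_zero]
  refine ⟨fun t => ⟨?_, ?_, ?_⟩, fun s => ?_, fun s => ?_⟩
  · intro s s' hs
    refine h₁.orderIso.symm.strictMono (mul_lt_mul_of_pos_left (h₂.strictMono hs) ?_)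
    simpa using Real.exp_pos _
  · exact h₁.orderIso.symm.continuous.comp (continuous_const.mul h₂.continuous)
  · simp [h₂.map_zero, h0]
  · intro t t' ht
    refine h₁.orderIso.symm.monotone ?_
    gcongr
  · rw [← h0]
    refine (h₁.orderIso.symm.continuous.tendsto 0).comp ?_
    rw [← zero_mul (a₂ s)]
    refine Tendsto.mul_const _ ?_
    rw [← Real.toNNReal_zero]
    refine (continuous_real_toNNReal.tendsto 0).comp ?_
    exact Real.tendsto_exp_neg_atTop_nhds_zero.comp (NNReal.tendsto_coe_atTop.2 tendsto_id)

end ComparisonFunctions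

/-! ### Converse Lyapunov theorem for abstract semiflows. -/

section ConverseLyapunov

variable {E : Type*} {X : Set E} {N : E → ℝ≥0} {φ : ℝ≥0 → X → X}
  {σ : ℝ≥0 → ℝ≥0 → ℝ≥0}

/-- The functional `sup_s e^s max(N(φ(s, x)) - δ, 0)`. -/
noncomputable def weightedExcess (N : E → ℝ≥0) (φ : ℝ≥0 → X → X) (δ : ℝ) (x : X) : ℝ :=
  ⨆ s : ℝ≥0, Real.exp s * max (N (φ s x) - δ) 0

/-- Monotonicity in the first argument lets the decay of `σ R` serve the whole ball of radius `R`.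
-/
lemma ClassKL.exists_forall_le (hσ : ClassKL σ) (R : ℝ≥0) {δ : ℝ} (hδ : 0 < δ) :
    ∃ T : ℝ≥0, ∀ s ≤ R, ∀ t, T ≤ t → (σ s t : ℝ) ≤ δ := by
  have h : ∀ᶠ t in atTop, σ R t ≤ δ.toNNReal :=
    ((hσ.tendsto_zero R).eventually_lt_const (by simpa using hδ)).mono fun _ h => h.le
  obtain ⟨T, hT⟩ := eventually_atTop.1 h
  refine ⟨T, fun s hs t ht => ?_⟩
  have := ((hσ.classK t).strictMono.monotone hs).trans (hT t ht)
  calc (σ s t : ℝ) ≤ (δ.toNNReal : ℝ) := by exact_mod_cast this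
    _ = δ := Real.coe_toNNReal _ hδ.le

lemma weightedExcess_nonneg (δ : ℝ) (x : X) : 0 ≤ weightedExcess N φ δ x :=
  Real.iSup_nonneg fun _ => mul_nonneg (Real.exp_pos _).le (le_max_right _ _)

variable [AddGroup E]

/-- A semiflow `φ` on `X`, with size measured by `N`, that is uniformly globally asymptotically
stable with rate `σ` and Lipschitz on bounded sets, uniformly on bounded time intervals. -/
structure IsStableSemiflow (N : E → ℝ≥0) (φ : ℝ≥0 → X → X) (σ : ℝ≥0 → ℝ≥0 → ℝ≥0) : Prop where
  classKL : ClassKL σ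
  zero_mem : (0 : E) ∈ X
  map_zero : N 0 = 0
  le_add : ∀ x ∈ X, ∀ y ∈ X, N x ≤ N y + N (x - y)
  sub_comm : ∀ x ∈ X, ∀ y ∈ X, N (x - y) = N (y - x)
  flow_zero : ∀ x, φ 0 x = x
  flow_add : ∀ s t x, φ (s + t) x = φ s (φ t x)
  le_rate : ∀ x t, N (φ t x) ≤ σ (N x) t
  lipschitz : ∀ R T : ℝ≥0, ∃ C : ℝ≥0, ∀ x y : X, N x ≤ R → N y ≤ R → ∀ s ≤ T,
    N ((φ s x : E) - φ s y) ≤ C * N ((x : E) - y)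

namespace IsStableSemiflow

/-- The excess over `δ` vanishes from a finite time on, so no rate of decay is needed to compensate
`e^s`. -/
lemma bddAbove_excess (h : IsStableSemiflow N φ σ) {δ : ℝ} (hδ : 0 < δ) (x : X) :
    BddAbove (range fun s : ℝ≥0 => Real.exp s * max (N (φ s x) - δ) 0) := by
  obtain ⟨T, hT⟩ := h.classKL.exists_forall_le (N x) hδ
  refine ⟨Real.exp T * σ (N x) 0, ?_⟩
  rintro _ ⟨s, rfl⟩
  rcases le_total s T with hs | hs
  · refine mul_le_mul (Real.exp_le_exp.2 hs) (max_le ?_ (NNReal.coe_nonneg _))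
      (le_max_right _ _) (Real.exp_pos _).le
    have : (N (φ s x) : ℝ) ≤ σ (N x) 0 := by
      exact_mod_cast (h.le_rate x s).trans (h.classKL.antitone _ (zero_le : 0 ≤ s))
    linarith
  · have h1 : (N (φ s x) : ℝ) ≤ σ (N x) s := by exact_mod_cast h.le_rate x s
    have h2 := hT _ le_rfl s hs
    simp only [max_eq_right (show (N (φ s x) : ℝ) - δ ≤ 0 by linarith), mul_zero]
    positivity

lemma excess_le_weightedExcess (h : IsStableSemiflow N φ σ) {δ : ℝ} (hδ : 0 < δ) (x : X) :
    (N x : ℝ) - δ ≤ weightedExcess N φ δ x := by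
  refine le_trans ?_ (le_ciSup (h.bddAbove_excess hδ x) 0)
  simp [h.flow_zero]

/-- The orbit of `φ t x` is a tail of the orbit of `x`, and `e^s = e^{-t} e^{s+t}`. -/
lemma weightedExcess_flow_le (h : IsStableSemiflow N φ σ) {δ : ℝ} (hδ : 0 < δ) (t : ℝ≥0) (x : X) :
    weightedExcess N φ δ (φ t x) ≤ Real.exp (-(t : ℝ)) * weightedExcess N φ δ x := by
  refine ciSup_le fun s => ?_
  have := le_ciSup (h.bddAbove_excess hδ x) (s + t)
  calc Real.exp s * max (N (φ s (φ t x)) - δ) 0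
      = Real.exp (-(t : ℝ)) * (Real.exp (s + t : ℝ≥0) * max (N (φ (s + t) x) - δ) 0) := by
        rw [h.flow_add, ← mul_assoc, ← Real.exp_add]
        push_cast
        ring_nf
    _ ≤ _ := mul_le_mul_of_nonneg_left this (Real.exp_pos _).le

lemma weightedExcess_zero (h : IsStableSemiflow N φ σ) {δ : ℝ} (hδ : 0 < δ) :
    weightedExcess N φ δ ⟨0, h.zero_mem⟩ = 0 := by
  have h0 : ∀ s, N (φ s ⟨0, h.zero_mem⟩) = 0 := fun s => by
    have := h.le_rate ⟨0, h.zero_mem⟩ s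
    rw [h.map_zero, (h.classKL.classK s).map_zero] at this
    exact le_antisymm this zero_le
  simp [weightedExcess, h0, hδ.le]

/-- Past the entry time `T` common to the `R`-ball the terms vanish; before it, truncation at `δ` is
1-Lipschitz and the flow is `C`-Lipschitz, which gives `M = e^T C`. -/
lemma weightedExcess_lipschitz (h : IsStableSemiflow N φ σ) {δ : ℝ} (hδ : 0 < δ) (R : ℝ≥0) :
    ∃ M : ℝ≥0, ∀ x y : X, N x ≤ R → N y ≤ R →
      weightedExcess N φ δ x ≤ weightedExcess N φ δ y + M * N ((x : E) - y) := by
  obtain ⟨T, hT⟩ := h.classKL.exists_forall_le R hδ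
  obtain ⟨C, hC⟩ := h.lipschitz R T
  refine ⟨(Real.exp T).toNNReal * C, fun x y hx hy => ciSup_le fun s => ?_⟩
  rw [NNReal.coe_mul, Real.coe_toNNReal _ (Real.exp_pos _).le]
  have hsup := le_ciSup (h.bddAbove_excess hδ y) s
  rcases le_total s T with hs | hs
  · have h1 : (N (φ s x) : ℝ) ≤ N (φ s y) + C * N ((x : E) - y) := by
      exact_mod_cast (h.le_add _ (φ s x).2 _ (φ s y).2).trans
        (add_le_add_right (hC x y hx hy s hs) _)
    have h2 : max (N (φ s x) - δ) 0 ≤ max (N (φ s y) - δ) 0 + C * N ((x : E) - y) :=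
      max_le (by linarith [le_max_left ((N (φ s y) : ℝ) - δ) 0])
        (add_nonneg (le_max_right _ _) (by positivity))
    calc Real.exp s * max (N (φ s x) - δ) 0
        ≤ Real.exp s * (max (N (φ s y) - δ) 0 + C * N ((x : E) - y)) := by gcongr
      _ = Real.exp s * max (N (φ s y) - δ) 0 + Real.exp s * (C * N ((x : E) - y)) := by ring
      _ ≤ weightedExcess N φ δ y + Real.exp T * (C * N ((x : E) - y)) := by
        refine add_le_add hsup (mul_le_mul_of_nonneg_right (Real.exp_le_exp.2 hs) (by positivity))
      _ = _ := by ring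
  · have h1 : (N (φ s x) : ℝ) ≤ σ (N x) s := by exact_mod_cast h.le_rate x s
    have h2 := hT _ hx s hs
    rw [max_eq_right (show (N (φ s x) : ℝ) - δ ≤ 0 by linarith), mul_zero]
    exact add_nonneg (weightedExcess_nonneg _ _) (by positivity)

/-- Converse Lyapunov theorem for semiflows that are Lipschitz on bounded sets. -/
theorem exists_lyapunov (h : IsStableSemiflow N φ σ) :
    ∃ (V : X → ℝ≥0) (a₁ a₂ : ℝ≥0 → ℝ≥0),
      (∀ R : ℝ≥0, ∃ L : ℝ≥0, ∀ x y : X, N x ≤ R → N y ≤ R →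
        |(V x : ℝ) - V y| ≤ L * N ((x : E) - y)) ∧
      ClassKInfty a₁ ∧ ClassKInfty a₂ ∧ (∀ x : X, a₁ (N x) ≤ V x ∧ V x ≤ a₂ (N x)) ∧
      ∀ (x : X) (t : ℝ≥0), (V (φ t x) : ℝ) ≤ Real.exp (-(t : ℝ)) * V x := by
  set δ : ℕ → ℝ := fun k => 1 / ((k : ℝ) + 1) with hδdef
  have hδ : ∀ k, 0 < δ k := fun k => Nat.one_div_pos_of_nat
  have hMex := fun (k : ℕ) (R : ℝ≥0) => h.weightedExcess_lipschitz (hδ k) R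
  choose M hM using hMex
  set W : ℕ → X → ℝ := fun k => weightedExcess N φ (δ k) with hW
  have hW0 : ∀ k x, 0 ≤ W k x := fun k x => weightedExcess_nonneg _ _
  -- The `k`-th weight is tuned to the Lipschitz constant on the ball of radius `k`. For any fixed
  -- `R`, all `k ≥ R` are then dominated by `2^{-k}`.
  set c : ℕ → ℝ := fun k => (1 / 2) ^ k / (1 + M k k) with hc
  have hden : ∀ k, (0 : ℝ) < 1 + M k k := fun k => by positivity
  have hcpos : ∀ k, 0 < c k := fun k => div_pos (by positivity) (hden k)
  have hcle : ∀ k, c k ≤ (1 / 2) ^ k := fun k =>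
    div_le_self (by positivity) (by simp)
  have hcsum : Summable c :=
    Summable.of_nonneg_of_le (fun k => (hcpos k).le) hcle summable_geometric_two
  -- A Lipschitz constant of `W k` on the `R`-ball, taken from the larger `k`-ball when `R ≤ k`, so
  -- that the diagonal choice of `c` applies.
  set m : ℝ≥0 → ℕ → ℝ := fun R k => if R ≤ k then M k k else M k R with hm
  have hm0 : ∀ R k, 0 ≤ m R k := fun R k => by
    simp only [hm]; split_ifs <;> positivity
  have hmsum : ∀ R, Summable fun k => c k * m R k := fun R => by
    refine Summable.of_norm_bounded_eventually_nat summable_geometric_two ?_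
    obtain ⟨K, hK⟩ := exists_nat_ge R
    filter_upwards [eventually_ge_atTop K] with k hk
    have hRk : R ≤ k := hK.trans (by exact_mod_cast hk)
    rw [Real.norm_of_nonneg (mul_nonneg (hcpos k).le (hm0 R k))]
    simp only [hm, hRk, if_true, hc]
    rw [div_mul_eq_mul_div, div_le_iff₀ (hden k)]
    gcongr
    linarith
  have hlip : ∀ R k, ∀ x y : X, N x ≤ R → N y ≤ R →
      W k x ≤ W k y + m R k * N ((x : E) - y) := by
    intro R k x y hx hy
    by_cases hRk : R ≤ k
    · simp only [hm, hRk, if_true]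
      exact hM k k x y (hx.trans hRk) (hy.trans hRk)
    · simp only [hm, hRk, if_false]
      exact hM k R x y hx hy
  have hWle : ∀ R k, ∀ x : X, N x ≤ R → W k x ≤ m R k * N x := by
    intro R k x hx
    have := hlip R k x ⟨0, h.zero_mem⟩ hx (by simp [h.map_zero])
    simpa [hW, h.weightedExcess_zero (hδ k)] using this
  have hsum : ∀ x, Summable fun k => c k * W k x := fun x => by
    refine Summable.of_nonneg_of_le (fun k => mul_nonneg (hcpos k).le (hW0 k x)) (fun k => ?_)
      ((hmsum (N x)).mul_right (N x : ℝ))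
    rw [mul_assoc]
    exact mul_le_mul_of_nonneg_left (hWle _ k x le_rfl) (hcpos k).le
  set V : X → ℝ := fun x => ∑' k, c k * W k x with hV
  have hV0 : ∀ x, 0 ≤ V x := fun x => tsum_nonneg fun k => mul_nonneg (hcpos k).le (hW0 k x)
  have hVcoe : ∀ x, ((V x).toNNReal : ℝ) = V x := fun x => Real.coe_toNNReal _ (hV0 x)
  set L : ℝ≥0 → ℝ := fun R => ∑' k, c k * m R k with hL
  have hL0 : ∀ R, 0 ≤ L R := fun R => tsum_nonneg fun k => mul_nonneg (hcpos k).le (hm0 R k)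
  have hVlip : ∀ R, ∀ x y : X, N x ≤ R → N y ≤ R → V x ≤ V y + L R * N ((x : E) - y) := by
    intro R x y hx hy
    simp only [hV, hL]
    rw [← tsum_mul_right, ← (hsum y).tsum_add ((hmsum R).mul_right _)]
    refine (hsum x).tsum_le_tsum (fun k => ?_) ((hsum y).add ((hmsum R).mul_right _))
    calc c k * W k x ≤ c k * (W k y + m R k * N ((x : E) - y)) :=
          mul_le_mul_of_nonneg_left (hlip R k x y hx hy) (hcpos k).le
      _ = _ := by ring
  have hVle : ∀ R, ∀ x : X, N x ≤ R → V x ≤ L R * N x := by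
    intro R x hx
    simp only [hV, hL]
    rw [← tsum_mul_right]
    refine (hsum x).tsum_le_tsum (fun k => ?_) ((hmsum R).mul_right _)
    rw [mul_assoc]
    exact mul_le_mul_of_nonneg_left (hWle _ k x hx) (hcpos k).le
  obtain ⟨a₂, ha₂, hle₂⟩ := exists_classKInfty_majorant fun R => (L R).toNNReal
  -- The `s = 0` term of each supremum gives this lower bound for `V`. It is positive for `s > 0`
  -- because `δ k → 0`.
  set g : ℝ≥0 → ℝ := fun s => ∑' k, c k * max ((s : ℝ) - δ k) 0 with hg
  have hterm : ∀ s : ℝ≥0, ∀ k, 0 ≤ c k * max ((s : ℝ) - δ k) 0 := fun s k =>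
    mul_nonneg (hcpos k).le (le_max_right _ _)
  have hgsum : ∀ s : ℝ≥0, Summable fun k => c k * max ((s : ℝ) - δ k) 0 := fun s => by
    refine Summable.of_nonneg_of_le (hterm s) (fun k => ?_) (hcsum.mul_right (s : ℝ))
    exact mul_le_mul_of_nonneg_left (max_le (by linarith [hδ k]) s.2) (hcpos k).le
  have hg0 : ∀ s, 0 ≤ g s := fun s => tsum_nonneg (hterm s)
  have hgV : ∀ x : X, g (N x) ≤ V x := fun x => by
    refine (hgsum _).tsum_le_tsum (fun k => ?_) (hsum x)
    exact mul_le_mul_of_nonneg_left (max_le (h.excess_le_weightedExcess (hδ k) x) (hW0 k x))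
      (hcpos k).le
  have hgmono : StrictMono g := by
    intro s t hst
    have ht : (0 : ℝ) < t := by exact_mod_cast (zero_le : 0 ≤ s).trans_lt hst
    have hst' : (s : ℝ) < t := hst
    obtain ⟨k, hk⟩ := exists_nat_one_div_lt ht
    refine (hgsum s).tsum_lt_tsum (i := k) (fun j => ?_) ?_ (hgsum t)
    · refine mul_le_mul_of_nonneg_left (max_le_max ?_ le_rfl) (hcpos j).le
      linarith
    · refine mul_lt_mul_of_pos_left ?_ (hcpos k)
      refine lt_of_lt_of_le (max_lt ?_ ?_) (le_max_left _ _)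
      · linarith
      · simpa [hδdef] using hk
  have hgcont : Continuous g := by
    refine continuous_iff_continuousAt.2 fun s₀ => ?_
    have hon : ContinuousOn g (Iio (s₀ + 1)) := by
      refine continuousOn_tsum (u := fun k => c k * (s₀ + 1)) (fun k => by fun_prop)
        (hcsum.mul_right _) fun k s hs => ?_
      rw [Real.norm_of_nonneg (hterm s k)]
      have hs' : (s : ℝ) < s₀ + 1 := by exact_mod_cast hs
      exact mul_le_mul_of_nonneg_left (max_le (by linarith [hδ k]) (by positivity)) (hcpos k).le
    exact hon.continuousAt (Iio_mem_nhds (by simp))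
  have hgtop : Tendsto g atTop atTop := by
    have hge : ∀ s : ℝ≥0, c 0 * ((s : ℝ) - δ 0) ≤ g s := fun s =>
      (mul_le_mul_of_nonneg_left (le_max_left _ _) (hcpos 0).le).trans
        ((hgsum s).le_tsum 0 fun j _ => hterm s j)
    refine tendsto_atTop_mono hge (Tendsto.const_mul_atTop (hcpos 0) ?_)
    exact tendsto_atTop_add_const_right _ _ (NNReal.tendsto_coe_atTop.2 tendsto_id)
  have hgz : g 0 = 0 := by
    simp only [hg]
    convert tsum_zero with k
    simp [(hδ k).le]
  refine ⟨fun x => (V x).toNNReal, fun s => (g s).toNNReal, a₂, fun R => ⟨(L R).toNNReal, ?_⟩,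
    ⟨⟨?_, ?_, ?_⟩, ?_⟩, ha₂, fun x => ⟨Real.toNNReal_mono (hgV x), ?_⟩, fun x t => ?_⟩
  · intro x y hx hy
    rw [hVcoe, hVcoe, Real.coe_toNNReal _ (hL0 R), abs_sub_le_iff]
    have h1 := hVlip R x y hx hy
    have h2 := hVlip R y x hy hx
    rw [h.sub_comm _ y.2 _ x.2] at h2
    constructor <;> linarith
  · intro s t hst
    exact (Real.toNNReal_lt_toNNReal_iff_of_nonneg (hg0 s)).2 (hgmono hst)
  · fun_prop
  · simp [hgz]
  · exact tendsto_real_toNNReal_atTop.comp hgtop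
  · refine le_trans ?_ (hle₂ (N x))
    rw [← NNReal.coe_le_coe, hVcoe, NNReal.coe_mul, Real.coe_toNNReal _ (hL0 _)]
    exact hVle _ x (Nat.le_ceil _)
  · rw [hVcoe, hVcoe]
    simp only [hV]
    rw [← tsum_mul_left]
    refine (hsum _).tsum_le_tsum (fun k => ?_) ((hsum x).mul_left _)
    calc c k * W k (φ t x) ≤ c k * (Real.exp (-(t : ℝ)) * W k x) :=
          mul_le_mul_of_nonneg_left (h.weightedExcess_flow_le (hδ k) t x) (hcpos k).le
      _ = _ := by ring

end IsStableSemiflow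

end ConverseLyapunov

/-! ### Gronwall estimate with delay. -/

section DelayGronwall

variable {F : Type*} [NormedAddCommGroup F] [NormedSpace ℝ F]

/-- Gronwall's inequality with delay: if `|z'(t)|` is bounded by `K` times the maximum of `|z|` over
`[t - r, t]`, then `z` grows at most exponentially. -/
lemma norm_le_exp_of_norm_deriv_le_delayed {z d : ℝ → F} {r T K A : ℝ} (hr : 0 ≤ r) (hT : 0 ≤ T)
    (hK : 0 ≤ K) (hz : ContinuousOn z (Icc 0 T))
    (hd : ∀ t ∈ Ico 0 T, HasDerivWithinAt z (d t) (Ici 0) t)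
    (hA : ∀ u ∈ Icc (-r) 0, ‖z u‖ ≤ A)
    (hbound : ∀ t ∈ Ico 0 T, ∀ b, (∀ u ∈ Icc (t - r) t, ‖z u‖ ≤ b) → ‖d t‖ ≤ K * b) :
    ∀ t ∈ Icc (-r) T, ‖z t‖ ≤ 2 * A * Real.exp ((2 * K + 1) * T) := by
  -- With `K ≤ l / 2`, integrating `K W e^{lt}` costs only half of the weighted maximum `W`, which
  -- can be absorbed.
  set l : ℝ := 2 * K + 1 with hl
  have hlpos : 0 < l := by positivity
  have hA0 : 0 ≤ A := (norm_nonneg _).trans (hA 0 ⟨by linarith, le_rfl⟩)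
  obtain ⟨t₀, ht₀, hmax⟩ := isCompact_Icc.exists_isMaxOn (nonempty_Icc.2 hT)
    (f := fun t => Real.exp (-(l * t)) * ‖z t‖)
    (ContinuousOn.mul (by fun_prop) hz.norm)
  set W₀ : ℝ := Real.exp (-(l * t₀)) * ‖z t₀‖ with hW₀
  set W : ℝ := max A W₀ with hW
  have hW0 : 0 ≤ W := hA0.trans (le_max_left _ _)
  have hzW : ∀ t ∈ Icc 0 T, ‖z t‖ ≤ W * Real.exp (l * t) := by
    intro t ht
    have h1 : Real.exp (-(l * t)) * ‖z t‖ ≤ W := (hmax ht).trans (le_max_right _ _)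
    rw [Real.exp_neg, inv_mul_le_iff₀ (Real.exp_pos _)] at h1
    linarith
  have hdW : ∀ t ∈ Ico 0 T, ‖d t‖ ≤ K * (W * Real.exp (l * t)) := by
    intro t ht
    refine hbound t ht _ fun u hu => ?_
    rcases le_total u 0 with hu0 | hu0
    · refine (hA u ⟨by linarith [hu.1, ht.1], hu0⟩).trans ((le_max_left A W₀).trans ?_)
      exact le_mul_of_one_le_right hW0 (Real.one_le_exp (mul_nonneg hlpos.le ht.1))
    · refine (hzW u ⟨hu0, hu.2.trans ht.2.le⟩).trans ?_
      gcongr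
      exact hu.2
  have hmain : ∀ t ∈ Icc 0 T, ‖z t‖ ≤ A + W / 2 * (Real.exp (l * t) - 1) := by
    refine image_norm_le_of_norm_deriv_right_le_deriv_boundary hz
      (f' := d) (B' := fun t => W / 2 * (Real.exp (l * t) * l))
      (fun t ht => (hd t ht).mono (Ici_subset_Ici.2 ht.1)) ?_ ?_ ?_
    · simpa using hA 0 ⟨by linarith, le_rfl⟩
    · intro t
      have h1 : HasDerivAt (fun t : ℝ => l * t) l t := by
        simpa using (hasDerivAt_id t).const_mul l
      exact ((h1.exp.sub_const 1).const_mul (W / 2)).const_add A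
    · intro t ht
      refine (hdW t ht).trans ?_
      have := mul_nonneg hW0 (Real.exp_pos (l * t)).le
      nlinarith
  -- Evaluate at the maximizer `t₀` and divide by `e^{l t₀} ≥ 1`.
  have hW₀le : W₀ ≤ A + W / 2 := by
    have h1 := hmain t₀ ht₀
    have h2 : 1 ≤ Real.exp (l * t₀) := Real.one_le_exp (mul_nonneg hlpos.le ht₀.1)
    rw [hW₀, Real.exp_neg, inv_mul_le_iff₀ (Real.exp_pos _)]
    nlinarith
  have hW2 : W ≤ 2 * A := by
    rcases max_choice A W₀ with hc | hc <;> rw [← hW] at hc <;> linarith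
  intro t ht
  rcases le_total t 0 with ht0 | ht0
  · have h1 : 1 ≤ Real.exp (l * T) := Real.one_le_exp (mul_nonneg hlpos.le hT)
    have h2 := hA t ⟨ht.1, ht0⟩
    nlinarith
  · refine (hzW t ⟨ht0, ht.2⟩).trans ?_
    gcongr
    exact ht.2

end DelayGronwall

/-! ### Solutions: dependence on initial data, uniqueness, time shifts. -/

section Solutions

variable {n : ℕ} {r : ℝ}

lemma segment_apply (x : C(Ici (-r), EuclideanSpace ℝ (Fin n))) (t : ℝ≥0) (s : Icc (-r) 0) :
    segment x t s = IciExtend x (t + s) := by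
  have h : (t + s : ℝ) ∈ Ici (-r) := by
    have h1 : -r ≤ (s : ℝ) := s.2.1
    have h2 : (0 : ℝ) ≤ t := t.2
    exact mem_Ici.2 (by linarith)
  rw [IciExtend_of_mem (x := (t + s : ℝ)) _ h]
  rfl

lemma segment_sub (x y : C(Ici (-r), EuclideanSpace ℝ (Fin n))) (t : ℝ≥0) :
    segment (x - y) t = segment x t - segment y t := rfl

lemma continuous_IciExtend (x : C(Ici (-r), EuclideanSpace ℝ (Fin n))) :
    Continuous (IciExtend x) :=
  x.continuous.comp (Continuous.subtype_mk (continuous_const.max continuous_id) _)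

lemma norm_segment_le_iff (x : C(Ici (-r), EuclideanSpace ℝ (Fin n))) (t : ℝ≥0) {b : ℝ}
    (hb : 0 ≤ b) : ‖segment x t‖ ≤ b ↔ ∀ u ∈ Icc (t - r : ℝ) t, ‖IciExtend x u‖ ≤ b := by
  rw [ContinuousMap.norm_le _ hb]
  constructor
  · intro h u hu
    have := h ⟨u - t, by linarith [hu.1], by linarith [hu.2]⟩
    rw [segment_apply] at this
    simpa using this
  · intro h s
    rw [segment_apply]
    exact h _ ⟨by linarith [s.2.1], by linarith [s.2.2]⟩

/-- The segments of a curve are bounded on bounded time intervals. -/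
lemma exists_norm_segment_le (x : C(Ici (-r), EuclideanSpace ℝ (Fin n))) (T : ℝ≥0) :
    ∃ R : ℝ≥0, ∀ t ≤ T, ‖segment x t‖ ≤ R := by
  obtain ⟨C, hC⟩ := (isCompact_Icc (a := -r) (b := (T : ℝ))).exists_bound_of_continuousOn
    (continuous_IciExtend x).continuousOn
  refine ⟨C.toNNReal, fun t ht => (norm_segment_le_iff x t (NNReal.coe_nonneg _)).2 fun u hu => ?_⟩
  have ht' : (t : ℝ) ≤ T := ht
  exact (hC u ⟨by linarith [hu.1, t.2], hu.2.trans ht'⟩).trans (Real.le_coe_toNNReal C)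

variable {f : Hist n r → EuclideanSpace ℝ (Fin n)}

lemma IsGlobalSolution.hasDerivWithinAt_sub {x₀ y₀ : Hist n r}
    {x y : C(Ici (-r), EuclideanSpace ℝ (Fin n))}
    (hx : IsGlobalSolution f x₀ x) (hy : IsGlobalSolution f y₀ y) (t : ℝ≥0) :
    HasDerivWithinAt (IciExtend (x - y)) (f (segment x t) - f (segment y t)) (Ici 0) (t : ℝ) :=
  (hx.deriv_eq t).sub (hy.deriv_eq t)

/-- Lipschitz dependence of solutions on the initial condition, in the sup norm. -/
lemma IsGlobalSolution.norm_segment_sub_le (hr : 0 ≤ r) {x₀ y₀ : Hist n r}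
    {x y : C(Ici (-r), EuclideanSpace ℝ (Fin n))}
    (hx : IsGlobalSolution f x₀ x) (hy : IsGlobalSolution f y₀ y) {K R : ℝ≥0}
    (hf : ∀ u v : Hist n r, ‖u‖ ≤ R → ‖v‖ ≤ R → ‖f u - f v‖ ≤ K * ‖u - v‖) {T : ℝ≥0}
    (hxR : ∀ t ≤ T, ‖segment x t‖ ≤ R) (hyR : ∀ t ≤ T, ‖segment y t‖ ≤ R) :
    ∀ t ≤ T, ‖segment x t - segment y t‖ ≤
      2 * ‖x₀ - y₀‖ * Real.exp ((2 * K + 1) * T) := by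
  have hinit : segment (x - y) 0 = x₀ - y₀ := by rw [segment_sub, hx.initial, hy.initial]
  have key := norm_le_exp_of_norm_deriv_le_delayed (z := IciExtend (x - y))
    (d := fun t => f (segment x t.toNNReal) - f (segment y t.toNNReal)) (A := ‖x₀ - y₀‖)
    (T := T) (K := K) hr T.2 K.2 (continuous_IciExtend _).continuousOn ?_ ?_ ?_
  · intro t ht
    have ht' : (t : ℝ) ≤ T := ht
    rw [← segment_sub, norm_segment_le_iff _ _ (by positivity)]
    exact fun u hu => key u ⟨by linarith [hu.1, t.2], hu.2.trans ht'⟩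
  · intro t ht
    simpa [Real.coe_toNNReal _ ht.1] using hx.hasDerivWithinAt_sub hy t.toNNReal
  · have := (norm_segment_le_iff (x - y) 0 (norm_nonneg (x₀ - y₀))).1 (by rw [hinit])
    simpa using this
  · intro t ht b hb
    have htT : t.toNNReal ≤ T := Real.toNNReal_le_iff_le_coe.2 ht.2.le
    refine (hf _ _ (hxR _ htT) (hyR _ htT)).trans ?_
    rw [← segment_sub]
    refine mul_le_mul_of_nonneg_left ?_ K.2
    have hb0 : 0 ≤ b := (norm_nonneg _).trans (hb t ⟨by linarith, le_rfl⟩)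
    rw [norm_segment_le_iff _ _ hb0, Real.coe_toNNReal _ ht.1]
    exact hb

/-- Uniqueness of solutions. -/
lemma IsGlobalSolution.segment_eq (hr : 0 ≤ r) (hf : LipschitzOnBounded f) {x₀ : Hist n r}
    {x y : C(Ici (-r), EuclideanSpace ℝ (Fin n))}
    (hx : IsGlobalSolution f x₀ x) (hy : IsGlobalSolution f x₀ y) (t : ℝ≥0) :
    segment x t = segment y t := by
  obtain ⟨L, -, hL⟩ := hf
  obtain ⟨R₁, h₁⟩ := exists_norm_segment_le x t
  obtain ⟨R₂, h₂⟩ := exists_norm_segment_le y t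
  have := hx.norm_segment_sub_le hr hy (hL (max R₁ R₂))
    (fun s hs => (h₁ s hs).trans (by simp)) (fun s hs => (h₂ s hs).trans (by simp)) t le_rfl
  rw [← sub_eq_zero, ← norm_le_zero_iff]
  simpa using this

/-- The curve `u ↦ x(t + u)`. -/
noncomputable def shift (x : C(Ici (-r), EuclideanSpace ℝ (Fin n))) (t : ℝ≥0) :
    C(Ici (-r), EuclideanSpace ℝ (Fin n)) where
  toFun u := IciExtend x (t + u)
  continuous_toFun := (continuous_IciExtend x).comp (by fun_prop)

lemma IciExtend_shift (x : C(Ici (-r), EuclideanSpace ℝ (Fin n))) (t : ℝ≥0) {u : ℝ}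
    (hu : -r ≤ u) : IciExtend (shift x t) u = IciExtend x (t + u) :=
  IciExtend_of_mem _ (mem_Ici.2 hu)

lemma segment_shift (x : C(Ici (-r), EuclideanSpace ℝ (Fin n))) (s t : ℝ≥0) :
    segment (shift x t) s = segment x (s + t) := by
  ext1 u
  rw [segment_apply, segment_apply, IciExtend_shift x t (by linarith [u.2.1, s.2])]
  push_cast
  ring_nf

lemma IsGlobalSolution.shift (hr : 0 ≤ r) {x₀ : Hist n r}
    {x : C(Ici (-r), EuclideanSpace ℝ (Fin n))} (hx : IsGlobalSolution f x₀ x) (t : ℝ≥0) :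
    IsGlobalSolution f (segment x t) (shift x t) := by
  refine ⟨by rw [segment_shift, zero_add], fun s => ?_⟩
  have h0 : HasDerivWithinAt (fun u : ℝ => (t : ℝ) + u) 1 (Ici 0) (s : ℝ) :=
    ((hasDerivAt_id (s : ℝ)).const_add (t : ℝ)).hasDerivWithinAt
  have h1 := hx.deriv_eq (t + s)
  rw [NNReal.coe_add] at h1
  have h2 := h1.scomp (s : ℝ) h0 fun u hu => mem_Ici.2 (add_nonneg t.2 hu)
  rw [segment_shift, add_comm s t]
  rw [one_smul] at h2
  exact h2.congr (fun u hu => IciExtend_shift x t (by linarith [mem_Ici.1 hu]))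
    (IciExtend_shift x t (by linarith [s.2]))

end Solutions

/-! ### The equivalence in an abstract state space. -/

section StateSpaces

variable {n : ℕ} {r : ℝ} {X : Set (Hist n r)} {N : Hist n r → ℝ≥0}

/-- A state space of histories whose norm is finer than the sup norm, and in which the segments of a
curve are controlled by the initial segment and a bound for the derivative. -/
structure IsStateSpace (X : Set (Hist n r)) (N : Hist n r → ℝ≥0) : Prop where
  zero_mem : (0 : Hist n r) ∈ X
  sub_mem : ∀ x ∈ X, ∀ y ∈ X, x - y ∈ X
  map_zero : N 0 = 0
  le_add : ∀ x ∈ X, ∀ y ∈ X, N x ≤ N y + N (x - y)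
  map_neg : ∀ x, N (-x) = N x
  nnnorm_le : ∀ x, ‖x‖₊ ≤ N x
  segment_le : ∃ C : ℝ≥0, ∀ (z : C(Ici (-r), EuclideanSpace ℝ (Fin n)))
    (d : ℝ≥0 → EuclideanSpace ℝ (Fin n)),
    (∀ t : ℝ≥0, HasDerivWithinAt (IciExtend z) (d t) (Ici 0) (t : ℝ)) → segment z 0 ∈ X →
    ∀ s D : ℝ≥0, (∀ t ≤ s, ‖d t‖₊ ≤ D) →
      N (segment z s) ≤ ‖segment z s‖₊ + N (segment z 0) + C * D

variable {f : Hist n r → EuclideanSpace ℝ (Fin n)}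

/-- Lipschitz dependence of the state on the initial condition, in the norm of `X`. -/
lemma IsStateSpace.exists_segment_sub_le (hX : IsStateSpace X N) (hr : 0 ≤ r)
    (hf : LipschitzOnBounded f) (R T : ℝ≥0) :
    ∃ C : ℝ≥0, ∀ (x₀ y₀ : Hist n r) (x y : C(Ici (-r), EuclideanSpace ℝ (Fin n))),
      x₀ ∈ X → y₀ ∈ X → IsGlobalSolution f x₀ x → IsGlobalSolution f y₀ y →
      (∀ t, N (segment x t) ≤ R) → (∀ t, N (segment y t) ≤ R) →
      ∀ s ≤ T, N (segment x s - segment y s) ≤ C * N (x₀ - y₀) := by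
  obtain ⟨L, -, hL⟩ := hf
  obtain ⟨C, hC⟩ := hX.segment_le
  set c : ℝ≥0 := (2 * Real.exp ((2 * L R + 1) * T)).toNNReal with hc
  -- The three summands bound the sup norm, the initial difference, and the derivative `f(x_t) -
  -- f(y_t)`.
  refine ⟨c + 1 + C * (L R * c), fun x₀ y₀ x y hx₀ hy₀ hx hy hxR hyR s hs => ?_⟩
  have hxR' : ∀ t, ‖segment x t‖ ≤ R := fun t => (hX.nnnorm_le _).trans (hxR t)
  have hyR' : ∀ t, ‖segment y t‖ ≤ R := fun t => (hX.nnnorm_le _).trans (hyR t)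
  have hsup : ∀ t ≤ T, ‖segment x t - segment y t‖₊ ≤ c * N (x₀ - y₀) := by
    intro t ht
    have h1 := hx.norm_segment_sub_le hr hy (hL R) (fun t _ => hxR' t) (fun t _ => hyR' t) t ht
    have h2 : ‖segment x t - segment y t‖₊ ≤ c * ‖x₀ - y₀‖₊ := by
      rw [← NNReal.coe_le_coe]
      refine h1.trans_eq ?_
      rw [hc, NNReal.coe_mul, Real.coe_toNNReal _ (by positivity), coe_nnnorm]
      ring
    exact h2.trans (by gcongr; exact hX.nnnorm_le _)
  have hinit : segment (x - y) 0 = x₀ - y₀ := by rw [segment_sub, hx.initial, hy.initial]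
  have h := hC (x - y) _ (hx.hasDerivWithinAt_sub hy) (hinit ▸ hX.sub_mem _ hx₀ _ hy₀) s
    (L R * (c * N (x₀ - y₀))) fun t ht => by
      have h1 : ‖f (segment x t) - f (segment y t)‖₊ ≤ L R * ‖segment x t - segment y t‖₊ :=
        hL R _ _ (hxR' t) (hyR' t)
      exact h1.trans (by gcongr; exact hsup t (ht.trans hs))
  rw [hinit, segment_sub] at h
  calc N (segment x s - segment y s) ≤ _ := h
    _ ≤ c * N (x₀ - y₀) + N (x₀ - y₀) + C * (L R * (c * N (x₀ - y₀))) := by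
      gcongr
      exact hsup s hs
    _ = _ := by ring

/-- Uniform global asymptotic stability implies the existence of a Lyapunov functional. -/
theorem IsStateSpace.hasLyapunovFunctional_of_uGAS (hX : IsStateSpace X N) (hr : 0 ≤ r)
    (hf : LipschitzOnBounded f) (h : UGAS f X N) : HasLyapunovFunctional f X N := by
  obtain ⟨σ, hσ, hsol⟩ := h
  choose! sol hsol hmem using hsol
  have hmem' : ∀ (x : X) t, segment (sol x) t ∈ X := fun x t => (hmem x x.2 t).1
  set φ : ℝ≥0 → X → X := fun t x => ⟨segment (sol x) t, hmem' x t⟩ with hφ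
  have hflow : IsStableSemiflow N φ σ := by
    refine ⟨hσ, hX.zero_mem, hX.map_zero, hX.le_add, fun x _ y _ => ?_, fun x => ?_,
      fun s t x => ?_, fun x t => (hmem x x.2 t).2, fun R T => ?_⟩
    · rw [← hX.map_neg, neg_sub]
    · exact Subtype.ext (hsol x x.2).initial
    -- The semigroup law: the shifted solution and the chosen one share their initial segment, so
    -- uniqueness applies.
    · refine Subtype.ext ?_
      change segment (sol x) (s + t) = segment (sol (segment (sol x) t)) s
      rw [← segment_shift]
      exact ((hsol x x.2).shift hr t).segment_eq hr hf (hsol _ (hmem' x t)) s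
    · obtain ⟨C, hC⟩ := hX.exists_segment_sub_le hr hf (σ R 0) T
      have hb : ∀ x : X, N x ≤ R → ∀ t, N (segment (sol x) t) ≤ σ R 0 := fun x hx t =>
        ((hmem x x.2 t).2.trans (hσ.antitone _ zero_le)).trans
          ((hσ.classK 0).strictMono.monotone hx)
      exact ⟨C, fun x y hx hy s hs => hC x y _ _ x.2 y.2 (hsol x x.2) (hsol y y.2)
        (hb x hx) (hb y hy) s hs⟩
  obtain ⟨V, a₁, a₂, hlip, h₁, h₂, hbd, hdec⟩ := hflow.exists_lyapunov
  exact ⟨V, a₁, a₂, hlip, h₁, h₂, hbd, fun x => ⟨sol x, hsol x x.2, fun t => ⟨hmem' x t, hdec x t⟩⟩⟩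

/-- Existence of a Lyapunov functional implies uniform global asymptotic stability. -/
theorem HasLyapunovFunctional.uGAS (h : HasLyapunovFunctional f X N) : UGAS f X N := by
  obtain ⟨V, a₁, a₂, -, h₁, h₂, hbd, hsol⟩ := h
  refine ⟨_, classKL_symm_exp_mul h₁ h₂, fun x₀ hx₀ => ?_⟩
  obtain ⟨x, hx, hdec⟩ := hsol ⟨x₀, hx₀⟩
  refine ⟨x, hx, fun t => ?_⟩
  obtain ⟨hmem, hle⟩ := hdec t
  refine ⟨hmem, ?_⟩
  rw [OrderIso.le_symm_apply, h₁.orderIso_apply]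
  refine (hbd ⟨_, hmem⟩).1.trans ?_
  have h3 : V ⟨segment x t, hmem⟩ ≤ (Real.exp (-(t : ℝ))).toNNReal * V ⟨x₀, hx₀⟩ := by
    rw [← NNReal.coe_le_coe, NNReal.coe_mul, Real.coe_toNNReal _ (Real.exp_pos _).le]
    exact hle
  exact h3.trans (mul_le_mul_right (hbd ⟨x₀, hx₀⟩).2 _)

end StateSpaces

variable {n : ℕ} {r : ℝ}

/-! ### Hölder spaces. -/

section Hoelder

/-- The Hölder constant of a segment of `z` is controlled by the one of the initial segment and a
bound for the derivative of `z`. -/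
lemma holderWith_segment {a H D : ℝ≥0} (hr : 0 < r) (ha : a ≤ 1)
    {z : C(Ici (-r), EuclideanSpace ℝ (Fin n))} {d : ℝ≥0 → EuclideanSpace ℝ (Fin n)}
    (hd : ∀ t : ℝ≥0, HasDerivWithinAt (IciExtend z) (d t) (Ici 0) (t : ℝ))
    (hz : HolderWith H a (segment z 0)) {s : ℝ≥0} (hD : ∀ t ≤ s, ‖d t‖₊ ≤ D) :
    HolderWith (H + r.toNNReal ^ (1 - a : ℝ) * D) a (segment z s) := by
  have hpast : ∀ u v : ℝ, -r ≤ u → u ≤ v → v ≤ 0 →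
      ‖IciExtend z v - IciExtend z u‖ ≤ H * (v - u) ^ (a : ℝ) := by
    intro u v hu huv hv
    have h := hz.nndist_le ⟨v, hu.trans huv, hv⟩ ⟨u, hu, huv.trans hv⟩
    rw [← NNReal.coe_le_coe, NNReal.coe_mul, NNReal.coe_rpow, coe_nndist, coe_nndist,
      dist_eq_norm, segment_apply, segment_apply, Subtype.dist_eq, Real.dist_eq,
      abs_of_nonneg (by simpa using huv)] at h
    simpa using h
  have hfut : ∀ u v : ℝ, 0 ≤ u → u ≤ v → v ≤ s →
      ‖IciExtend z v - IciExtend z u‖ ≤ D * (v - u) := by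
    intro u v hu huv hv
    refine (convex_Icc (0 : ℝ) s).norm_image_sub_le_of_norm_hasDerivWithin_le
      (f' := fun t => d t.toNNReal) (fun t ht => ?_) (fun t ht => ?_)
      ⟨hu, huv.trans hv⟩ ⟨hu.trans huv, hv⟩ |>.trans_eq (by rw [Real.norm_of_nonneg (by linarith)])
    · have := (hd t.toNNReal).mono (Icc_subset_Ici_self : Icc (0 : ℝ) s ⊆ Ici 0)
      rwa [Real.coe_toNNReal _ ht.1] at this
    · exact_mod_cast hD _ (Real.toNNReal_le_iff_le_coe.2 ht.2)
  -- Since a segment has length `r`, a Lipschitz bound is also an `a`-Hölder bound.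
  have hlin : ∀ h : ℝ, 0 ≤ h → h ≤ r → h ≤ r ^ (1 - a : ℝ) * h ^ (a : ℝ) := by
    intro h h0 hhr
    have ha' : (0 : ℝ) ≤ 1 - a := sub_nonneg.2 (by exact_mod_cast ha)
    calc h = h ^ (1 - a + a : ℝ) := by simp
      _ = h ^ (1 - a : ℝ) * h ^ (a : ℝ) := Real.rpow_add_of_nonneg h0 ha' a.2
      _ ≤ _ := by gcongr
  have hmain : ∀ u v : ℝ, -r ≤ u → u ≤ v → v ≤ s → v - u ≤ r →
      ‖IciExtend z v - IciExtend z u‖ ≤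
        (H + r ^ (1 - a : ℝ) * D) * (v - u) ^ (a : ℝ) := by
    intro u v hu huv hv hvr
    have huv0 : 0 ≤ v - u := sub_nonneg.2 huv
    have hrpow : 0 ≤ r ^ (1 - a : ℝ) := Real.rpow_nonneg hr.le _
    have hpow : 0 ≤ (v - u) ^ (a : ℝ) := Real.rpow_nonneg huv0 _
    have hHpow : 0 ≤ (H : ℝ) * (v - u) ^ (a : ℝ) := mul_nonneg H.2 hpow
    have hDpow : (D : ℝ) * (v - u) ≤ D * (r ^ (1 - a : ℝ) * (v - u) ^ (a : ℝ)) :=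
      mul_le_mul_of_nonneg_left (hlin _ huv0 hvr) D.2
    have hDlin : 0 ≤ (D : ℝ) * (v - u) := mul_nonneg D.2 huv0
    rcases le_total v 0 with hv0 | hv0
    · refine (hpast u v hu huv hv0).trans ?_
      linarith
    rcases le_total 0 u with hu0 | hu0
    · refine (hfut u v hu0 huv hv).trans ?_
      linarith
    -- The two points straddle time `0`: split there, using both regimes.
    · have h1 := hpast u 0 hu hu0 le_rfl
      have h2 := hfut 0 v le_rfl hv0 hv
      have h3 : (H : ℝ) * (0 - u) ^ (a : ℝ) ≤ H * (v - u) ^ (a : ℝ) := by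
        refine mul_le_mul_of_nonneg_left (Real.rpow_le_rpow (by linarith) (by linarith) a.2) H.2
      have h4 : (D : ℝ) * (v - 0) ≤ D * (v - u) :=
        mul_le_mul_of_nonneg_left (by linarith) D.2
      have h5 := norm_sub_le_norm_sub_add_norm_sub (IciExtend z v) (IciExtend z 0) (IciExtend z u)
      linarith
  have hnn : ∀ u v : Icc (-r) 0, (u : ℝ) ≤ v → edist (segment z s u) (segment z s v) ≤
      ((H + r.toNNReal ^ (1 - a : ℝ) * D : ℝ≥0) : ℝ≥0∞) * edist u v ^ (a : ℝ) := by
    intro u v huv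
    rw [edist_nndist, edist_nndist, ← ENNReal.coe_rpow_of_nonneg _ (NNReal.coe_nonneg a), ← ENNReal.coe_mul,
      ENNReal.coe_le_coe, ← NNReal.coe_le_coe, coe_nndist, dist_comm, dist_eq_norm, segment_apply,
      segment_apply]
    have h := hmain (s + u) (s + v) (by linarith [u.2.1, s.2]) (by linarith) (by linarith [v.2.2])
      (by linarith [u.2.1, v.2.2])
    rw [add_sub_add_left_eq_sub] at h
    have hdist : dist u v = v - u := by
      rw [dist_comm, Subtype.dist_eq, Real.dist_eq, abs_of_nonneg (sub_nonneg.2 huv)]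
    push_cast
    rw [hdist, Real.coe_toNNReal _ hr.le]
    exact h
  intro u v
  rcases le_total (u : ℝ) v with huv | huv
  · exact hnn u v huv
  · rw [edist_comm, edist_comm u v]
    exact hnn v u huv

theorem isStateSpace_holderSpace (hr : 0 < r) {a : ℝ≥0} (ha : a ≤ 1) :
    IsStateSpace (holderSpace n r a) (holderNorm n r a) := by
  have hsub : ∀ x ∈ holderSpace n r a, ∀ y ∈ holderSpace n r a, x - y ∈ holderSpace n r a := by
    intro x hx y hy
    have hy' : MemHolder a ((-1 : ℝ) • (y : Icc (-r) 0 → EuclideanSpace ℝ (Fin n))) := hy.smul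
    have h := hx.add hy'
    rw [neg_one_smul, ← sub_eq_add_neg] at h
    exact h
  refine ⟨memHolder_zero, hsub, by simp [holderNorm], fun x hx y hy => ?_, fun x => ?_,
    fun x => le_max_left _ _, r.toNNReal ^ (1 - a : ℝ), fun z d hd hz s D hD => ?_⟩
  · refine max_le ?_ ?_
    · calc ‖x‖₊ = ‖y + (x - y)‖₊ := by rw [add_sub_cancel]
        _ ≤ ‖y‖₊ + ‖x - y‖₊ := nnnorm_add_le _ _
        _ ≤ _ := add_le_add (le_max_left _ _) (le_max_left _ _)
    · have h := MemHolder.nnHolderNorm_add_le (show MemHolder a y from hy)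
        (show MemHolder a (x - y) from hsub x hx y hy)
      rw [← ContinuousMap.coe_add, add_sub_cancel] at h
      exact h.trans (add_le_add (le_max_right _ _) (le_max_right _ _))
  · have h : eHolderNorm a (-(x : Icc (-r) 0 → EuclideanSpace ℝ (Fin n))) = eHolderNorm a x := by
      have := eHolderNorm_smul (r := a) (f := (x : Icc (-r) 0 → EuclideanSpace ℝ (Fin n))) (-1 : ℝ)
      rw [neg_one_smul] at this
      simpa using this
    simp only [holderNorm, nnHolderNorm, nnnorm_neg]
    rw [ContinuousMap.coe_neg, h]
  · have hz' : MemHolder a (segment z 0) := hz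
    have h := (holderWith_segment hr ha hd hz'.holderWith hD).nnholderNorm_le
    refine max_le (le_add_right le_self_add) (h.trans ?_)
    gcongr
    exact (le_max_right _ _).trans le_add_self

end Hoelder

/-! ### Sobolev spaces. -/

section Sobolev

lemma IccExtend_eq_IciExtend (hr : 0 ≤ r) (z : C(Ici (-r), EuclideanSpace ℝ (Fin n))) (s : ℝ≥0)
    {u : ℝ} (hu : u ∈ Icc (-r) 0) :
    IccExtend (by linarith : -r ≤ 0) (segment z s) u = IciExtend z (s + u) := by
  rw [IccExtend_of_mem _ _ hu, segment_apply]

lemma histDeriv_segment (hr : 0 < r) (z : C(Ici (-r), EuclideanSpace ℝ (Fin n))) (s : ℝ≥0)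
    {u : ℝ} (hu : u ∈ Ioo (-r) 0) :
    histDeriv hr (segment z s) u = deriv (IciExtend z) (s + u) := by
  rw [← deriv_comp_const_add]
  refine EventuallyEq.deriv_eq ?_
  filter_upwards [Ioo_mem_nhds hu.1 hu.2] with v hv
  exact IccExtend_eq_IciExtend hr.le z s (Ioo_subset_Icc_self hv)

/-- The `L^p` norm of the derivative of a segment of `z` is controlled by the one of the initial
segment and a bound for the derivative of `z`. -/
lemma eLpNorm_histDeriv_segment_le (hr : 0 < r) {p : ℝ≥0∞} (hp : 1 ≤ p)
    {z : C(Ici (-r), EuclideanSpace ℝ (Fin n))} {d : ℝ≥0 → EuclideanSpace ℝ (Fin n)}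
    (hd : ∀ t : ℝ≥0, HasDerivWithinAt (IciExtend z) (d t) (Ici 0) (t : ℝ)) {s D : ℝ≥0}
    (hD : ∀ t ≤ s, ‖d t‖₊ ≤ D) :
    eLpNorm (histDeriv hr (segment z s)) p (volume.restrict (Ioo (-r) 0)) ≤
      eLpNorm (histDeriv hr (segment z 0)) p (volume.restrict (Ioo (-r) 0)) +
        eLpNorm (fun _ => (1 : ℝ)) p (volume.restrict (Ioo (-r) 0)) * D := by
  set μ : Measure ℝ := volume.restrict (Ioo (-r) 0) with hμ
  set g : ℝ → EuclideanSpace ℝ (Fin n) := deriv (IciExtend z) with hg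
  -- Extending the initial derivative by zero to the line makes its norm translation invariant.
  set G : ℝ → EuclideanSpace ℝ (Fin n) := (Ioo (-r) 0).indicator g with hG
  have hgm : StronglyMeasurable g := stronglyMeasurable_deriv _
  have hGm : StronglyMeasurable G := hgm.indicator measurableSet_Ioo
  have hshift : StronglyMeasurable fun u : ℝ => G (s + u) :=
    hGm.comp_measurable (measurable_const_add _)
  have hinit : eLpNorm (histDeriv hr (segment z 0)) p μ = eLpNorm G p volume := by
    rw [hG, eLpNorm_indicator_eq_eLpNorm_restrict measurableSet_Ioo]
    refine eLpNorm_congr_ae ?_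
    filter_upwards [ae_restrict_mem measurableSet_Ioo] with u hu
    rw [histDeriv_segment hr z 0 hu]
    simp [hg]
  have hle : ∀ᵐ u ∂μ, ‖histDeriv hr (segment z s) u‖ ≤ ‖‖G (s + u)‖ + (D : ℝ)‖ := by
    -- At the junction `s + u = 0` the curve may have a corner; this is a null set.
    have hne : ∀ᵐ u ∂μ, u ≠ -(s : ℝ) := ae_restrict_of_ae (by simp [ae_iff, measure_singleton])
    filter_upwards [ae_restrict_mem measurableSet_Ioo, hne] with u hu hus
    rw [histDeriv_segment hr z s hu, Real.norm_of_nonneg (by positivity)]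
    rcases lt_or_gt_of_ne (show (s : ℝ) + u ≠ 0 from fun h => hus (by linarith)) with hneg | hpos
    · have hmem : (s : ℝ) + u ∈ Ioo (-r) 0 := ⟨by linarith [hu.1, s.2], hneg⟩
      rw [hG, indicator_of_mem hmem]
      simp [hg]
    · set t : ℝ≥0 := ⟨s + u, hpos.le⟩ with ht
      have h1 : HasDerivAt (IciExtend z) (d t) (s + u) := (hd t).hasDerivAt (Ici_mem_nhds hpos)
      have h2 : ‖d t‖ ≤ D := by
        exact_mod_cast hD t (show ((s : ℝ) + u) ≤ s by linarith [hu.2])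
      rw [h1.deriv]
      linarith [norm_nonneg (G (s + u))]
  calc eLpNorm (histDeriv hr (segment z s)) p μ
      ≤ eLpNorm ((fun u => ‖G (s + u)‖) + fun _ => (D : ℝ)) p μ := eLpNorm_mono_ae hle
    _ ≤ eLpNorm (fun u => ‖G (s + u)‖) p μ + eLpNorm (fun _ => (D : ℝ)) p μ :=
      eLpNorm_add_le hshift.norm.aestronglyMeasurable aestronglyMeasurable_const hp
    _ ≤ eLpNorm G p volume + eLpNorm (fun _ => (1 : ℝ)) p μ * D := by
      refine add_le_add ?_ (le_of_eq ?_)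
      · rw [eLpNorm_norm]
        refine (eLpNorm_restrict_le _ _ _ _).trans_eq ?_
        have := eLpNorm_comp_measurePreserving (p := p) (μ := volume) (ν := volume)
          hGm.aestronglyMeasurable (measurePreserving_add_left volume (s : ℝ))
        exact this
      · have := eLpNorm_const_smul (D : ℝ) (fun _ : ℝ => (1 : ℝ)) p μ
        rw [mul_comm]
        simpa [Pi.smul_def] using this
    _ = _ := by rw [hinit]

theorem isStateSpace_sobolevSpace (hr : 0 < r) {p : ℝ≥0∞} (hp : 1 ≤ p) :
    IsStateSpace (sobolevSpace n hr p) (sobolevNorm n hr p) := by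
  have hr0 : -r ≤ 0 := by linarith
  set μ : Measure ℝ := volume.restrict (Ioo (-r) 0) with hμ
  -- `deriv` is additive only where both functions are differentiable; absolute continuity gives
  -- this almost everywhere, through bounded variation.
  have hdiff : ∀ x ∈ sobolevSpace n hr p, ∀ᵐ u ∂μ, DifferentiableAt ℝ (IccExtend hr0 x) u := by
    intro x hx
    have h := hx.1.boundedVariationOn.ae_differentiableAt_of_mem_uIcc
    filter_upwards [ae_restrict_mem measurableSet_Ioo, ae_restrict_of_ae h] with u hu hu'
    exact hu' (by rw [uIcc_of_le hr0]; exact Ioo_subset_Icc_self hu)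
  have hderiv : ∀ x ∈ sobolevSpace n hr p, ∀ y ∈ sobolevSpace n hr p,
      histDeriv hr (x - y) =ᵐ[μ] histDeriv hr x - histDeriv hr y := by
    intro x hx y hy
    filter_upwards [hdiff x hx, hdiff y hy] with u hxu hyu
    exact deriv_sub hxu hyu
  have hsub : ∀ x ∈ sobolevSpace n hr p, ∀ y ∈ sobolevSpace n hr p,
      x - y ∈ sobolevSpace n hr p := fun x hx y hy =>
    ⟨hx.1.sub hy.1, (memLp_congr_ae (hderiv x hx y hy)).2 (hx.2.sub hy.2)⟩
  have hzero : histDeriv hr (0 : Hist n r) = 0 := by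
    have : IccExtend hr0 (0 : Hist n r) = fun _ => 0 := rfl
    ext1 u
    rw [histDeriv, this]
    simp
  have hmem0 : (0 : Hist n r) ∈ sobolevSpace n hr p := by
    refine ⟨?_, by rw [hzero]; exact MemLp.zero⟩
    have : IccExtend hr0 (0 : Hist n r) = fun _ => 0 := rfl
    rw [this]
    exact (LipschitzWith.const (0 : EuclideanSpace ℝ (Fin n))).lipschitzOnWith
      |>.absolutelyContinuousOnInterval
  have hone : eLpNorm (fun _ : ℝ => (1 : ℝ)) p μ ≠ ∞ := (memLp_const (1 : ℝ)).eLpNorm_ne_top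
  refine ⟨hmem0, hsub, by simp [sobolevNorm, hzero], fun x hx y hy => ?_, fun x => ?_,
    fun x => le_self_add, (eLpNorm (fun _ : ℝ => (1 : ℝ)) p μ).toNNReal,
    fun z d hd hz s D hD => ?_⟩
  · have h1 : ‖x‖₊ ≤ ‖y‖₊ + ‖x - y‖₊ := by
      simpa using nnnorm_add_le y (x - y)
    have h2 : eLpNorm (histDeriv hr x) p μ ≤
        eLpNorm (histDeriv hr y) p μ + eLpNorm (histDeriv hr (x - y)) p μ := by
      have heq : histDeriv hr x =ᵐ[μ] histDeriv hr y + histDeriv hr (x - y) := by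
        filter_upwards [hderiv x hx y hy] with u hu
        simp [hu]
      rw [eLpNorm_congr_ae heq]
      exact eLpNorm_add_le hy.2.1 (hsub x hx y hy).2.1 hp
    have hy2 := hy.2.eLpNorm_ne_top
    have hxy2 := (hsub x hx y hy).2.eLpNorm_ne_top
    have h3 := ENNReal.toNNReal_mono (ENNReal.add_ne_top.2 ⟨hy2, hxy2⟩) h2
    rw [ENNReal.toNNReal_add hy2 hxy2] at h3
    calc sobolevNorm n hr p x ≤ _ := add_le_add h1 h3
      _ = _ := add_add_add_comm _ _ _ _
  · have h : histDeriv hr (-x) = -histDeriv hr x := by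
      ext1 u
      exact deriv.neg
    simp only [sobolevNorm, nnnorm_neg, h, eLpNorm_neg]
  · have hz2 := hz.2.eLpNorm_ne_top
    have hD2 : eLpNorm (fun _ : ℝ => (1 : ℝ)) p μ * D ≠ ∞ := ENNReal.mul_ne_top hone (by simp)
    have h := ENNReal.toNNReal_mono (ENNReal.add_ne_top.2 ⟨hz2, hD2⟩)
      (eLpNorm_histDeriv_segment_le hr hp hd hD)
    rw [ENNReal.toNNReal_add hz2 hD2, ENNReal.toNNReal_mul, ENNReal.toNNReal_coe] at h
    rw [add_assoc]
    refine add_le_add_right (h.trans ?_) _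
    exact add_le_add_left le_add_self _

end Sobolev

end DelaySystem

theorem theorem5 {n : ℕ} {r : ℝ} (hr : 0 < r) {p : ℝ≥0∞} (hp : 1 < p)
    (f : DelaySystem.Hist n r → EuclideanSpace ℝ (Fin n)) (hf0 : f 0 = 0)
    (hf : DelaySystem.LipschitzOnBounded f) :
    (DelaySystem.UGAS f (DelaySystem.sobolevSpace n hr p) (DelaySystem.sobolevNorm n hr p) ↔
      DelaySystem.HasLyapunovFunctional f
        (DelaySystem.sobolevSpace n hr p) (DelaySystem.sobolevNorm n hr p)) ∧
    (DelaySystem.UGAS f (DelaySystem.holderSpace n r (1 - p⁻¹).toNNReal)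
        (DelaySystem.holderNorm n r (1 - p⁻¹).toNNReal) ↔
      DelaySystem.HasLyapunovFunctional f (DelaySystem.holderSpace n r (1 - p⁻¹).toNNReal)
        (DelaySystem.holderNorm n r (1 - p⁻¹).toNNReal)) := by
  -- For `p = ∞` the exponent is `1`, the Lipschitz case.
  have ha : (1 - p⁻¹).toNNReal ≤ 1 := ENNReal.toNNReal_mono ENNReal.one_ne_top tsub_le_self
  exact ⟨⟨(DelaySystem.isStateSpace_sobolevSpace hr hp.le).hasLyapunovFunctional_of_uGAS hr.le hf,
      DelaySystem.HasLyapunovFunctional.uGAS⟩,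
    ⟨(DelaySystem.isStateSpace_holderSpace hr ha).hasLyapunovFunctional_of_uGAS hr.le hf,
      DelaySystem.HasLyapunovFunctional.uGAS⟩⟩
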